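/- Let $q$ be an odd prime power and let $\ell>1$ and $d$ be integers with $0<d<2\ell$ and $\gcd(\ell,d)=1$. Let $\omega\in\mathbb F_{q^{2\ell}}\setminus\mathbb F_{q^\ell}$ with $\omega^{q^\ell}=-\omega$, and let $\beta\in\mathbb F_{q^{2\ell}}^*$ be such that $$\beta^{\frac{q^{2\ell}-1}{\gcd(q^\ell+1,\,q^d+1)}}\neq 1,$$ and assume that there is no $a\in\mathbb F_{q^{2\ell}}^*$ with $a+a^{q^\ell}=a+a^{q^d}=0$. Let $\overline{BH}(q,\ell,d,\beta)=(\mathbb F_{q^{2\ell}},+,\star)$ be the Budaghyan–Helleseth presemifield with multiplication $$x\star y=xy^{q^\ell}+x^{q^\ell}y+\bigl[\beta(xy^{q^d}+x^{q^d}y)+\beta^{q^\ell}(xy^{q^d}+x^{q^d}y)^{q^\ell}\bigr]\omega .$$ A finite presemifield is a finite nonzero abelian group with a biadditive multiplication without zero divisors; it is a semifield if it also has a multiplicative identity. Two presemifields $(S,+,\star)$, $(S',+,\star')$ are isotopic if there are additive bijections $g_1,g_2,g_3:S\to S'$ with $g_1(x)\star' g_2(y)=g_3(x\star y)$ for all $x,y$.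 For a presemifield $(S,+,\star)$ of characteristic $p$ let $\mathcal C=\{\varphi_y: x\mapsto x\star y \mid y\in S\}\subseteq \mathbb V=\mathrm{End}_{\mathbb F_p}(S)$, and let $\mathcal C^d$ be the same set for the dual multiplication $x\star^d y=y\star x$. Its middle nucleus $\mathcal N_m$ (respectively right nucleus $\mathcal N_r$, left nucleus $\mathcal N_l$) is the largest field of maps contained in $\mathbb V$ with $\mathcal C\mathcal N_m\subseteq\mathcal C$ (respectively $\mathcal N_r\mathcal C\subseteq\mathcal C$, $\mathcal N_l\mathcal C^d\subseteq\mathcal C^d$). For a fixed invertible $w\in\mathcal C$, its center is the largest field $\mathcal K_{r,w}$ contained in $\mathcal N_r$ with $\rho\varphi=\varphi\,(w^{-1}\rho w)$ for all $\rho\in\mathcal K_{r,w}$ and $\varphi\in\mathcal C$. Then $\overline{BH}(q,\ell,d,\beta)$ is indeed a presemifield, and the following hold. 1. Every semifield isotopic to $\overline{BH}(q,\ell,d,\beta)$ has middle nucleus of order $q^2$, and right nucleus, left nucleus and center all of order $q$. 2. The middle nucleus $\mathcal N_m$ of $\overline{BH}(q,\ell,d,\beta)$ exists and has order $q^2$.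 Its right nucleus $\mathcal N_r$, its left nucleus $\mathcal N_l$ and (for every invertible $w\in\mathcal C$) its center $\mathcal K_{r,w}$ exist and have order $q$. 3. There is $\xi\in\mathbb F_{q^{2\ell}}$ with $\xi^{q^{\ell+d}-1}=\beta^{1-q^\ell}$, and for every such $\xi$ $$\mathcal N_m=\{\,x\mapsto ax+b\,\xi\, x^{q^\ell} \mid a,b\in\mathbb F_q\,\}.$$ -/

import Mathlib

universe u v

namespace PreSF

/-- A finite presemifield `(S, +, mul)`: a finite nonzero abelian group with a biadditive
multiplication without zero divisors (by finiteness the left and right multiplications by nonzero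
elements are then bijective). -/
structure IsPresemifield {S : Type*} [AddCommGroup S] (mul : S → S → S) : Prop where
  finite : Finite S
  nontrivial : Nontrivial S
  mul_add : ∀ a b c, mul a (b + c) = mul a b + mul a c
  add_mul : ∀ a b c, mul (a + b) c = mul a c + mul b c
  eq_zero_or_eq_zero : ∀ a b, mul a b = 0 → a = 0 ∨ b = 0

/-- A finite semifield: a finite presemifield with a two-sided multiplicative identity. -/
structure IsSemifield {S : Type*} [AddCommGroup S] (mul : S → S → S) : Prop
    extends IsPresemifield mul where
  exists_one : ∃ e, ∀ a, mul e a = a ∧ mul a e = a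

/-- The left nucleus of a semifield. -/
def leftNucleus {S : Type*} (mul : S → S → S) : Set S :=
  {a | ∀ b c, mul (mul a b) c = mul a (mul b c)}

/-- The middle nucleus of a semifield. -/
def middleNucleus {S : Type*} (mul : S → S → S) : Set S :=
  {b | ∀ a c, mul (mul a b) c = mul a (mul b c)}

/-- The right nucleus of a semifield. -/
def rightNucleus {S : Type*} (mul : S → S → S) : Set S :=
  {c | ∀ a b, mul (mul a b) c = mul a (mul b c)}

/-- The center of a semifield. -/
def center {S : Type*} (mul : S → S → S) : Set S :=
  {a | a ∈ leftNucleus mul ∩ middleNucleus mul ∩ rightNucleus mul ∧ ∀ b, mul a b = mul b a}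

/-- Isotopy of presemifields. Additive bijections of elementary abelian `p`-groups are the same as
invertible `𝔽_p`-linear maps. -/
def Isotopic {S T : Type*} [AddCommGroup S] [AddCommGroup T]
    (mul : S → S → S) (mul' : T → T → T) : Prop :=
  ∃ g₁ g₂ g₃ : S ≃+ T, ∀ x y, mul' (g₁ x) (g₂ y) = g₃ (mul x y)

/-- The multiplication of the dual presemifield. -/
def dual {S : Type*} (mul : S → S → S) : S → S → S := fun x y => mul y x

/-- The spread set of a presemifield: the right multiplications `x ↦ mul x y`, as elements of the
ring of additive (that is, `𝔽_p`-linear) endomorphisms, whose product is composition. -/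
def spreadSet {S : Type*} [AddCommGroup S] (mul : S → S → S) : Set (AddMonoid.End S) :=
  {φ | ∃ y, ∀ x, φ x = mul x y}

/-- `N` is the largest field of endomorphisms with `N C ⊆ C`, where `C` is the spread set. -/
def IsRightNucleusOf {S : Type*} [AddCommGroup S] (mul : S → S → S)
    (N : Subring (AddMonoid.End S)) : Prop :=
  IsGreatest {M : Subring (AddMonoid.End S) | IsField M ∧
    ∀ μ ∈ M, ∀ φ ∈ spreadSet mul, μ * φ ∈ spreadSet mul} N

/-- `N` is the largest field of endomorphisms with `C N ⊆ C`, where `C` is the spread set. -/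
def IsMiddleNucleusOf {S : Type*} [AddCommGroup S] (mul : S → S → S)
    (N : Subring (AddMonoid.End S)) : Prop :=
  IsGreatest {M : Subring (AddMonoid.End S) | IsField M ∧
    ∀ μ ∈ M, ∀ φ ∈ spreadSet mul, φ * μ ∈ spreadSet mul} N

/-- `N` is the largest field of endomorphisms with `N C' ⊆ C'`, where `C'` is the spread set of
the dual presemifield. -/
def IsLeftNucleusOf {S : Type*} [AddCommGroup S] (mul : S → S → S)
    (N : Subring (AddMonoid.End S)) : Prop :=
  IsRightNucleusOf (dual mul) N

/-- `K` is the largest field contained in the right nucleus `N` (a field of endomorphisms) such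
that `ρ φ = φ (w⁻¹ ρ w)` for all `ρ ∈ K` and all `φ` in the spread set. Here `w` is a chosen
invertible element of the spread set. -/
def IsCenterOf {S : Type*} [AddCommGroup S] (mul : S → S → S) (w : (AddMonoid.End S)ˣ)
    (K : Subring (AddMonoid.End S)) : Prop :=
  ∃ N : Subring (AddMonoid.End S), IsRightNucleusOf mul N ∧
    IsGreatest {M : Subring (AddMonoid.End S) | IsField M ∧ M ≤ N ∧
      ∀ ρ ∈ M, ∀ φ ∈ spreadSet mul,
        ρ * φ = φ * ((↑w⁻¹ : AddMonoid.End S) * ρ * (w : AddMonoid.End S))} K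

/-- The Budaghyan–Helleseth multiplication. -/
def bhMul {F : Type*} [Field F] (q l d : ℕ) (β ω : F) (x y : F) : F :=
  x * y ^ q ^ l + x ^ q ^ l * y +
    (β * (x * y ^ q ^ d + x ^ q ^ d * y) +
      β ^ q ^ l * (x * y ^ q ^ d + x ^ q ^ d * y) ^ q ^ l) * ω

/-- The conditions on the parameters of the Budaghyan–Helleseth presemifield on the field `F`
with `q ^ (2 * l)` elements. -/
structure BHConditions (F : Type*) [Field F] (q l d : ℕ) (β ω : F) : Prop where
  q_primePow : IsPrimePow q
  q_odd : Odd q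
  card_eq : Nat.card F = q ^ (2 * l)
  d_pos : 0 < d
  d_lt : d < 2 * l
  coprime : Nat.gcd l d = 1
  ω_notMem : ω ^ q ^ l ≠ ω
  ω_conj : ω ^ q ^ l = -ω
  β_ne_zero : β ≠ 0
  β_pow_ne_one : β ^ ((q ^ (2 * l) - 1) / Nat.gcd (q ^ l + 1) (q ^ d + 1)) ≠ 1
  not_exists : ¬ ∃ a : F, a ≠ 0 ∧ a + a ^ q ^ l = 0 ∧ a + a ^ q ^ d = 0

end PreSF

open PreSF

/-! Write `s` and `δ` for the powers `q ^ l` and `q ^ d`. Since `s ω = -ω`, the elements `1, ω` are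
independent over the fixed field of `s`, so an identity between products splits into one for `A(x,
y) = x * s y + s x * y` and one for `B(x, y) = Tr(β * (x * δ y + δ x * y))`, where `Tr z = z + s z`.

Middle nucleus: `μ` belongs to it iff `μ x ⋆ y = x ⋆ τ y` for some map `τ`. Adjointness for `A`
forces `μ x = m * x + k * s x`. In the identity for `B`, independence of the distinct homomorphisms
`id, s, δ, s ∘ δ` gives `s (δ m) = m` and `s β * s k = β * δ k` (`TwistData.formula_of_mul_eq`). As
`gcd(l + d, 2l) = 1`, the first says `m ∈ 𝔽_q`, and the second says that `k` lies on an `𝔽_q`-line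
spanned by a root `ξ`. These necessary conditions are also sufficient, so the order is `q ^ 2`.

Right nucleus: if `ρ (x ⋆ y) = x ⋆ σ y`, commutativity makes `σ` self-adjoint for `⋆`, so `σ` has
the same shape. Modulo the scalar `m`, `ρ (x ⋆ y) = (k * s x) ⋆ y`. Expanded in automorphisms, the
left side contains only products of two different automorphisms, whereas the right side contains `s
k * (x * y)`; hence `k = 0` (`TwistData.coeff_eq_zero_of_right`). Only scalars from `𝔽_q` remain.
Commutativity gives the left nucleus, and these scalars are central. -/

namespace PreSF

/-! ### Nuclei as rings of endomorphisms, and their isotopy invariance. -/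

section General

variable {S : Type*} [AddCommGroup S] {mul : S → S → S}

/-- The multiplication `x ↦ mul x y` as an additive endomorphism. -/
def IsPresemifield.rmul (h : IsPresemifield mul) (y : S) : AddMonoid.End S :=
  AddMonoidHom.mk' (fun x => mul x y) fun a b => h.add_mul a b y

@[simp]
theorem IsPresemifield.rmul_apply (h : IsPresemifield mul) (x y : S) : h.rmul y x = mul x y := rfl

theorem IsPresemifield.mul_zero (h : IsPresemifield mul) (x : S) : mul x 0 = 0 := by
  simpa using h.mul_add x 0 0

theorem IsPresemifield.mul_neg (h : IsPresemifield mul) (x y : S) : mul x (-y) = -mul x y := by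
  rw [eq_neg_iff_add_eq_zero, ← h.mul_add, neg_add_cancel, h.mul_zero]

theorem IsPresemifield.rmul_injective (h : IsPresemifield mul) {y : S} (hy : y ≠ 0) :
    Function.Injective (h.rmul y) := by
  refine (injective_iff_map_eq_zero _).2 fun x hx => ?_
  exact (h.eq_zero_or_eq_zero x y hx).resolve_right hy

theorem IsPresemifield.rmul_surjective (h : IsPresemifield mul) {y : S} (hy : y ≠ 0) :
    Function.Surjective (h.rmul y) :=
  have := h.finite
  Finite.surjective_of_injective (h.rmul_injective hy)

theorem IsPresemifield.rmul_mem (h : IsPresemifield mul) (y : S) : h.rmul y ∈ spreadSet mul :=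
  ⟨y, fun _ => rfl⟩

theorem IsPresemifield.zero_mem (h : IsPresemifield mul) : 0 ∈ spreadSet mul :=
  ⟨0, fun x => by rw [h.mul_zero]; rfl⟩

theorem IsPresemifield.add_mem (h : IsPresemifield mul) {φ ψ : AddMonoid.End S}
    (hφ : φ ∈ spreadSet mul) (hψ : ψ ∈ spreadSet mul) : φ + ψ ∈ spreadSet mul := by
  obtain ⟨y, hy⟩ := hφ
  obtain ⟨z, hz⟩ := hψ
  exact ⟨y + z, fun x => by rw [h.mul_add, ← hy, ← hz]; rfl⟩

theorem IsPresemifield.neg_mem (h : IsPresemifield mul) {φ : AddMonoid.End S}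
    (hφ : φ ∈ spreadSet mul) : -φ ∈ spreadSet mul := by
  obtain ⟨y, hy⟩ := hφ
  exact ⟨-y, fun x => by rw [h.mul_neg, ← hy]; rfl⟩

/-- The ring of all endomorphisms `μ` with `C μ ⊆ C`, for the spread set `C`. -/
def IsPresemifield.middleRing (h : IsPresemifield mul) : Subring (AddMonoid.End S) where
  carrier := {μ | ∀ φ ∈ spreadSet mul, φ * μ ∈ spreadSet mul}
  mul_mem' ha hb φ hφ := by rw [← mul_assoc]; exact hb _ (ha _ hφ)
  one_mem' φ hφ := by rwa [mul_one]
  add_mem' ha hb φ hφ := by rw [_root_.mul_add]; exact h.add_mem (ha _ hφ) (hb _ hφ)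
  zero_mem' φ _ := by rw [MulZeroClass.mul_zero]; exact h.zero_mem
  neg_mem' ha φ hφ := by rw [_root_.mul_neg]; exact h.neg_mem (ha _ hφ)

/-- The ring of all endomorphisms `ρ` with `ρ C ⊆ C`, for the spread set `C`. -/
def IsPresemifield.rightRing (h : IsPresemifield mul) : Subring (AddMonoid.End S) where
  carrier := {ρ | ∀ φ ∈ spreadSet mul, ρ * φ ∈ spreadSet mul}
  mul_mem' ha hb φ hφ := by rw [mul_assoc]; exact ha _ (hb _ hφ)
  one_mem' φ hφ := by rwa [one_mul]
  add_mem' ha hb φ hφ := by rw [_root_.add_mul]; exact h.add_mem (ha _ hφ) (hb _ hφ)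
  zero_mem' φ _ := by rw [MulZeroClass.zero_mul]; exact h.zero_mem
  neg_mem' ha φ hφ := by rw [_root_.neg_mul]; exact h.neg_mem (ha _ hφ)

theorem IsPresemifield.mem_middleRing (h : IsPresemifield mul) {μ : AddMonoid.End S} :
    μ ∈ h.middleRing ↔ ∀ y, ∃ y', ∀ x, mul (μ x) y = mul x y' :=
  ⟨fun H y => H _ (h.rmul_mem y), fun H φ ⟨y, hy⟩ => by
    obtain ⟨y', hy'⟩ := H y
    exact ⟨y', fun x => by rw [← hy']; exact hy (μ x)⟩⟩

theorem IsPresemifield.mem_rightRing (h : IsPresemifield mul) {ρ : AddMonoid.End S} :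
    ρ ∈ h.rightRing ↔ ∀ y, ∃ y', ∀ x, ρ (mul x y) = mul x y' :=
  ⟨fun H y => H _ (h.rmul_mem y), fun H φ ⟨y, hy⟩ => by
    obtain ⟨y', hy'⟩ := H y
    exact ⟨y', fun x => by rw [← hy', ← hy]; rfl⟩⟩

/-- Injectivity of the nonzero maps excludes zero divisors; a finite domain is a field by
Wedderburn's little theorem. Applied to the full rings of nuclear maps, this makes each of them the
largest field required. -/
theorem isField_of_injective [Finite S] [Nontrivial S] (R : Subring (AddMonoid.End S))
    (hR : ∀ μ ∈ R, μ ≠ 0 → Function.Injective μ) : IsField R := by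
  have : Finite (AddMonoid.End S) := DFunLike.finite _
  have : NoZeroDivisors R := ⟨fun {a b} hab => by
    by_contra! hne
    refine hne.2 (Subtype.ext (AddMonoidHom.ext fun x => ?_))
    have ha := hR a a.2 fun h => hne.1 (Subtype.ext h)
    apply ha
    have := DFunLike.congr_fun (congrArg Subtype.val hab) x
    exact this.trans (map_zero (a : AddMonoid.End S)).symm⟩
  have : Nontrivial R := ⟨0, 1, fun h01 => by
    obtain ⟨x, hx⟩ := exists_ne (0 : S)
    exact hx (DFunLike.congr_fun (congrArg Subtype.val h01) x).symm⟩
  have : IsDomain R := NoZeroDivisors.to_isDomain R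
  exact Finite.isDomain_to_isField R

theorem IsPresemifield.isField_middleRing (h : IsPresemifield mul) : IsField h.middleRing := by
  have := h.finite
  have := h.nontrivial
  refine isField_of_injective _ fun μ hμ hne => ?_
  obtain ⟨y, hy⟩ := exists_ne (0 : S)
  obtain ⟨y', hy'⟩ := h.mem_middleRing.1 hμ y
  rcases eq_or_ne y' 0 with rfl | h0
  · refine absurd (AddMonoidHom.ext fun x => ?_) hne
    have := hy' x
    rw [h.mul_zero] at this
    exact (h.eq_zero_or_eq_zero _ _ this).resolve_right hy
  · intro a b hab
    apply h.rmul_injective h0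
    rw [h.rmul_apply, h.rmul_apply, ← hy', ← hy', hab]

theorem IsPresemifield.isField_rightRing (h : IsPresemifield mul) : IsField h.rightRing := by
  have := h.finite
  have := h.nontrivial
  refine isField_of_injective _ fun ρ hρ hne => ?_
  obtain ⟨y, hy⟩ := exists_ne (0 : S)
  obtain ⟨y', hy'⟩ := h.mem_rightRing.1 hρ y
  rcases eq_or_ne y' 0 with rfl | h0
  · refine absurd (AddMonoidHom.ext fun x => ?_) hne
    obtain ⟨z, rfl⟩ := h.rmul_surjective hy x
    exact (hy' z).trans (h.mul_zero z)
  · intro a b hab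
    obtain ⟨a, rfl⟩ := h.rmul_surjective hy a
    obtain ⟨b, rfl⟩ := h.rmul_surjective hy b
    rw [h.rmul_apply, h.rmul_apply, hy', hy'] at hab
    rw [h.rmul_injective h0 hab]

theorem IsPresemifield.isMiddleNucleusOf_middleRing (h : IsPresemifield mul) :
    IsMiddleNucleusOf mul h.middleRing :=
  ⟨⟨h.isField_middleRing, fun _ hμ => hμ⟩, fun _ hM _ hμ => hM.2 _ hμ⟩

theorem IsPresemifield.isRightNucleusOf_rightRing (h : IsPresemifield mul) :
    IsRightNucleusOf mul h.rightRing :=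
  ⟨⟨h.isField_rightRing, fun _ hμ => hμ⟩, fun _ hM _ hμ => hM.2 _ hμ⟩

theorem IsPresemifield.dual (h : IsPresemifield mul) : IsPresemifield (dual mul) where
  finite := h.finite
  nontrivial := h.nontrivial
  mul_add a b c := h.add_mul b c a
  add_mul a b c := h.mul_add c a b
  eq_zero_or_eq_zero a b hab := (h.eq_zero_or_eq_zero b a hab).symm

theorem IsSemifield.dual (h : IsSemifield mul) : IsSemifield (dual mul) where
  toIsPresemifield := h.toIsPresemifield.dual
  exists_one := h.exists_one.imp fun _ he a => (he a).symm

theorem rightNucleus_dual {S : Type*} (mul : S → S → S) :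
    rightNucleus (PreSF.dual mul) = leftNucleus mul :=
  Set.ext fun _ => ⟨fun h b c => (h c b).symm, fun h b c => (h c b).symm⟩

/-- Evaluation at the identity `e` is a bijection from the nuclear endomorphisms to the nucleus,
with inverse `b ↦ (x ↦ mul x b)`. -/
theorem IsSemifield.ncard_middleNucleus (h : IsSemifield mul) :
    (middleNucleus mul).ncard = Nat.card h.toIsPresemifield.middleRing := by
  obtain ⟨e, he⟩ := h.exists_one
  rw [← SetLike.coe_sort_coe, Nat.card_coe_set_eq]
  have key : ∀ μ ∈ h.toIsPresemifield.middleRing, ∀ x, μ x = mul x (μ e) := fun μ hμ x => by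
    obtain ⟨y, hy⟩ := h.toIsPresemifield.mem_middleRing.1 hμ e
    have h1 := hy e
    rw [(he _).2, (he _).1] at h1
    rw [h1, ← hy, (he _).2]
  symm
  refine Set.ncard_congr (fun μ _ => μ e) (fun μ hμ a c => ?_) (fun μ ν hμ hν e' => ?_)
    fun b hb => ?_
  · obtain ⟨y, hy⟩ := h.toIsPresemifield.mem_middleRing.1 hμ c
    have h1 := hy e
    rw [(he _).1] at h1
    rw [← key μ hμ, h1, hy]
  · refine AddMonoidHom.ext fun x => ?_
    exact (key μ hμ x).trans ((congrArg (mul x) e').trans (key ν hν x).symm)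
  · refine ⟨h.toIsPresemifield.rmul b, ?_, (he b).1⟩
    exact h.toIsPresemifield.mem_middleRing.2 fun y => ⟨mul b y, fun x => hb x y⟩

theorem IsSemifield.rightRing_apply (h : IsSemifield mul) {e : S}
    (he : ∀ a, mul e a = a ∧ mul a e = a) {ρ : AddMonoid.End S}
    (hρ : ρ ∈ h.toIsPresemifield.rightRing) (x : S) : ρ x = mul x (ρ e) := by
  obtain ⟨y, hy⟩ := h.toIsPresemifield.mem_rightRing.1 hρ e
  have h1 := hy e
  rw [(he _).2, (he _).1] at h1
  rw [h1, ← hy, (he _).2]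

theorem IsSemifield.rmul_mem_rightRing (h : IsSemifield mul) {c : S} (hc : c ∈ rightNucleus mul) :
    h.toIsPresemifield.rmul c ∈ h.toIsPresemifield.rightRing :=
  h.toIsPresemifield.mem_rightRing.2 fun y => ⟨mul y c, fun x => hc x y⟩

theorem IsSemifield.ncard_rightNucleus (h : IsSemifield mul) :
    (rightNucleus mul).ncard = Nat.card h.toIsPresemifield.rightRing := by
  obtain ⟨e, he⟩ := h.exists_one
  rw [← SetLike.coe_sort_coe, Nat.card_coe_set_eq]
  symm
  refine Set.ncard_congr (fun μ _ => μ e) (fun μ hμ a b => ?_) (fun μ ν hμ hν e' => ?_)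
    fun c hc => ⟨h.toIsPresemifield.rmul c, h.rmul_mem_rightRing hc, (he c).1⟩
  · obtain ⟨y, hy⟩ := h.toIsPresemifield.mem_rightRing.1 hμ b
    have h1 := hy e
    rw [(he _).1, (he _).1] at h1
    rw [← h.rightRing_apply he hμ, ← h.rightRing_apply he hμ, h1, hy]
  · refine AddMonoidHom.ext fun x => ?_
    exact (h.rightRing_apply he hμ x).trans
      ((congrArg (mul x) e').trans (h.rightRing_apply he hν x).symm)

variable {T : Type*} [AddCommGroup T] {mul' : T → T → T}

theorem Isotopic.dual (h : Isotopic mul mul') : Isotopic (PreSF.dual mul) (PreSF.dual mul') := by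
  obtain ⟨g₁, g₂, g₃, h⟩ := h
  exact ⟨g₂, g₁, g₃, fun x y => h y x⟩

/-- Conjugation of endomorphisms by an additive bijection. -/
def conjEnd (g : S ≃+ T) (μ : AddMonoid.End S) : AddMonoid.End T :=
  (g.toAddMonoidHom.comp μ).comp g.symm.toAddMonoidHom

@[simp]
theorem conjEnd_apply (g : S ≃+ T) (μ : AddMonoid.End S) (x : T) :
    conjEnd g μ x = g (μ (g.symm x)) := rfl

theorem conjEnd_injective (g : S ≃+ T) : Function.Injective (conjEnd g) := fun μ ν e =>
  DFunLike.ext _ _ fun x => g.injective <| by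
    have := DFunLike.congr_fun e (g x)
    rwa [conjEnd_apply, conjEnd_apply, AddEquiv.symm_apply_apply] at this

theorem conjEnd_symm (g : S ≃+ T) (μ : AddMonoid.End T) : conjEnd g (conjEnd g.symm μ) = μ :=
  DFunLike.ext _ _ fun x => by
    rw [conjEnd_apply, conjEnd_apply, AddEquiv.symm_symm, AddEquiv.apply_symm_apply,
      AddEquiv.apply_symm_apply]

theorem conjEnd_mem_middleRing (h : IsPresemifield mul) (h' : IsPresemifield mul')
    {g₁ g₂ g₃ : S ≃+ T} (hg : ∀ x y, mul' (g₁ x) (g₂ y) = g₃ (mul x y)) {μ : AddMonoid.End S}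
    (hμ : μ ∈ h.middleRing) : conjEnd g₁ μ ∈ h'.middleRing := by
  refine h'.mem_middleRing.2 fun y => ?_
  obtain ⟨y, rfl⟩ := g₂.surjective y
  obtain ⟨y', hy'⟩ := h.mem_middleRing.1 hμ y
  refine ⟨g₂ y', fun x => ?_⟩
  obtain ⟨x, rfl⟩ := g₁.surjective x
  rw [conjEnd_apply, AddEquiv.symm_apply_apply, hg, hg, hy']

theorem conjEnd_mem_rightRing (h : IsPresemifield mul) (h' : IsPresemifield mul')
    {g₁ g₂ g₃ : S ≃+ T} (hg : ∀ x y, mul' (g₁ x) (g₂ y) = g₃ (mul x y)) {ρ : AddMonoid.End S}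
    (hρ : ρ ∈ h.rightRing) : conjEnd g₃ ρ ∈ h'.rightRing := by
  refine h'.mem_rightRing.2 fun y => ?_
  obtain ⟨y, rfl⟩ := g₂.surjective y
  obtain ⟨y', hy'⟩ := h.mem_rightRing.1 hρ y
  refine ⟨g₂ y', fun x => ?_⟩
  obtain ⟨x, rfl⟩ := g₁.surjective x
  rw [conjEnd_apply, hg, AddEquiv.symm_apply_apply, hg, hy']

theorem isotopism_symm {g₁ g₂ g₃ : S ≃+ T} (hg : ∀ x y, mul' (g₁ x) (g₂ y) = g₃ (mul x y))
    (x y : T) : mul (g₁.symm x) (g₂.symm y) = g₃.symm (mul' x y) := by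
  rw [AddEquiv.eq_symm_apply, ← hg, AddEquiv.apply_symm_apply, AddEquiv.apply_symm_apply]

theorem Isotopic.card_middleRing (hI : Isotopic mul mul') (h : IsPresemifield mul)
    (h' : IsPresemifield mul') : Nat.card h'.middleRing = Nat.card h.middleRing := by
  obtain ⟨g₁, g₂, g₃, hg⟩ := hI
  refine (Nat.card_congr (Equiv.ofBijective
    (fun μ : h.middleRing => (⟨_, conjEnd_mem_middleRing h h' hg μ.2⟩ : h'.middleRing))
    ⟨fun μ ν e => Subtype.ext (conjEnd_injective g₁ (congrArg Subtype.val e)), fun μ => ?_⟩)).symm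
  exact ⟨⟨_, conjEnd_mem_middleRing h' h (isotopism_symm hg) μ.2⟩, Subtype.ext (conjEnd_symm g₁ _)⟩

theorem Isotopic.card_rightRing (hI : Isotopic mul mul') (h : IsPresemifield mul)
    (h' : IsPresemifield mul') : Nat.card h'.rightRing = Nat.card h.rightRing := by
  obtain ⟨g₁, g₂, g₃, hg⟩ := hI
  refine (Nat.card_congr (Equiv.ofBijective
    (fun μ : h.rightRing => (⟨_, conjEnd_mem_rightRing h h' hg μ.2⟩ : h'.rightRing))
    ⟨fun μ ν e => Subtype.ext (conjEnd_injective g₃ (congrArg Subtype.val e)), fun μ => ?_⟩)).symm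
  exact ⟨⟨_, conjEnd_mem_rightRing h' h (isotopism_symm hg) μ.2⟩, Subtype.ext (conjEnd_symm g₃ _)⟩

/-- If the right nucleus of a presemifield consists of scalars, then the center of an isotopic
semifield is its right nucleus. -/
theorem Isotopic.center_eq (hI : Isotopic mul mul') (h : IsPresemifield mul)
    (h' : IsSemifield mul')
    (hs : ∀ ρ ∈ h.rightRing, ∀ x y, mul (ρ x) y = ρ (mul x y) ∧ mul x (ρ y) = ρ (mul x y)) :
    center mul' = rightNucleus mul' := by
  obtain ⟨g₁, g₂, g₃, hg⟩ := hI
  obtain ⟨e, he⟩ := h'.exists_one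
  refine Set.Subset.antisymm (fun a ha => ha.1.2) fun c hc => ?_
  have hρ := conjEnd_mem_rightRing h'.toIsPresemifield h (isotopism_symm hg)
    (h'.rmul_mem_rightRing hc)
  set ρ := conjEnd g₃.symm (h'.toIsPresemifield.rmul c) with hρdef
  have hρ3 : ∀ x, mul' (g₃ x) c = g₃ (ρ x) := fun x => by simp [hρdef]
  -- The maps `g₁` and `g₃` differ by right multiplication by `g₂.symm e`, which commutes with `ρ`;
  -- so `ρ` describes multiplication by `c` through `g₁` as well.
  have hρ1 : ∀ x, mul' (g₁ x) c = g₁ (ρ x) := fun x => by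
    have h1 : g₁ x = g₃ (mul x (g₂.symm e)) := by
      rw [← hg, AddEquiv.apply_symm_apply, (he _).2]
    have h2 : g₁ (ρ x) = g₃ (mul (ρ x) (g₂.symm e)) := by
      rw [← hg, AddEquiv.apply_symm_apply, (he _).2]
    rw [h1, hρ3, h2, (hs ρ hρ x _).1]
  have key : ∀ x y, mul' (mul' x y) c = mul' (mul' x c) y := fun x y => by
    obtain ⟨x, rfl⟩ := g₁.surjective x
    obtain ⟨y, rfl⟩ := g₂.surjective y
    rw [hg, hρ3, hρ1, hg, (hs ρ hρ x y).1]
  have hcomm : ∀ y, mul' c y = mul' y c := fun y => by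
    have := key e y
    rw [(he _).1, (he _).1] at this
    exact this.symm
  refine ⟨⟨⟨fun b y => ?_, fun x y => ?_⟩, hc⟩, hcomm⟩
  · rw [hcomm, hcomm, key]
  · rw [← key, hc, hcomm]

end General

/-! ### Expansions in field automorphisms and extraction of a coefficient. -/

section CharacterSums

/-- The automorphisms are independent over `L` by Dedekind, and there are as many of them as the
`L`-dimension of `L →ₗ[K] L`, so they span it. -/
theorem exists_eq_sum_algHom {K L : Type*} [Field K] [Field L] [Algebra K L]
    [FiniteDimensional K L] [IsGalois K L] (ρ : L →ₗ[K] L) :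
    ∃ r : (L →ₐ[K] L) → L, ∀ z, ρ z = ∑ g, r g * g z := by
  have hcard : Fintype.card (L →ₐ[K] L) = Module.finrank L (L →ₗ[K] L) := by
    rw [Module.finrank_linearMap_self, ← IsGalois.card_aut_eq_finrank K L,
      ← Nat.card_eq_fintype_card]
    exact (Nat.card_congr (algEquivEquivAlgHom K L).toEquiv).symm
  have hspan := (linearIndependent_algHom_toLinearMap K L L).span_eq_top_of_card_eq_finrank' hcard
  obtain ⟨r, hr⟩ := (Submodule.mem_span_range_iff_exists_fun L).1
    (hspan.symm ▸ Submodule.mem_top : ρ ∈ _)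
  refine ⟨r, fun z => ?_⟩
  rw [← hr, LinearMap.sum_apply]
  rfl

variable {F : Type*} [Field F] [Fintype F] [DecidableEq F]

/-- The map `x ↦ g x / x` is a nontrivial character of `Fˣ`, and such a character sums to zero. -/
theorem sum_ringHom_mul_inv_eq_zero {g : F →+* F} (hg : g ≠ RingHom.id F) :
    ∑ x : Fˣ, g x * (x : F)⁻¹ = 0 := by
  let f : Fˣ →* F :=
    { toFun := fun x => g x * (x : F)⁻¹
      map_one' := by simp
      map_mul' := fun x y => by simp only [Units.val_mul, map_mul, mul_inv]; ring }
  refine sum_hom_units_eq_zero f fun hf => hg (RingHom.ext fun x => ?_)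
  rcases eq_or_ne x 0 with rfl | hx
  · simp
  · have : g x * x⁻¹ = 1 := DFunLike.congr_fun hf (Units.mk0 x hx)
    simpa using eq_of_mul_inv_eq_one this

/-- The coefficient of `x y` in a function of two variables, written as a combination of products
of field automorphisms in `x` and in `y`. -/
def coeffXY : (F → F → F) →ₗ[F] F where
  toFun f := ∑ x : Fˣ, ∑ y : Fˣ, f x y * ((x : F)⁻¹ * (y : F)⁻¹)
  map_add' f g := by simp only [Pi.add_apply, add_mul, Finset.sum_add_distrib]
  map_smul' c f := by
    simp only [Pi.smul_apply, smul_eq_mul, mul_assoc, Finset.mul_sum, RingHom.id_apply]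

/-- The function `(x, y) ↦ a x * b y`. -/
def homMul (a b : F →+* F) : F → F → F := fun x y => a x * b y

theorem coeffXY_homMul (a b : F →+* F) :
    coeffXY (homMul a b) = (∑ x : Fˣ, a x * (x : F)⁻¹) * ∑ y : Fˣ, b y * (y : F)⁻¹ := by
  rw [Finset.sum_mul_sum]
  exact Finset.sum_congr rfl fun x _ => Finset.sum_congr rfl fun y _ => by rw [homMul]; ring

theorem coeffXY_homMul_eq_zero {a b : F →+* F} (h : a ≠ b) : coeffXY (homMul a b) = 0 := by
  rw [coeffXY_homMul]
  by_cases ha : a = RingHom.id F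
  · rw [sum_ringHom_mul_inv_eq_zero (g := b) (by rintro rfl; exact h ha), mul_zero]
  · rw [sum_ringHom_mul_inv_eq_zero ha, zero_mul]

theorem coeffXY_homMul_self_eq_zero {a : F →+* F} (h : a ≠ RingHom.id F) :
    coeffXY (homMul a a) = 0 := by
  rw [coeffXY_homMul, sum_ringHom_mul_inv_eq_zero h, zero_mul]

theorem coeffXY_homMul_id : coeffXY (homMul (RingHom.id F) (RingHom.id F)) = 1 := by
  have : ∑ x : Fˣ, RingHom.id F x * (x : F)⁻¹ = -1 := by
    simp [Fintype.card_units, Nat.cast_sub (Fintype.card_pos (α := F))]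
  rw [coeffXY_homMul, this]
  ring

end CharacterSums

/-! ### The multiplication for abstract homomorphisms `s` and `δ`. -/

section Twisted

variable {F : Type*} [Field F]

/-- The Budaghyan–Helleseth multiplication for two ring endomorphisms of the field. -/
def twistMul (s δ : F →+* F) (β ω x y : F) : F :=
  x * s y + s x * y + (β * (x * δ y + δ x * y) + s β * s (x * δ y + δ x * y)) * ω

/-- The relations between the parameters of a twisted multiplication. -/
structure TwistData (s δ : F →+* F) (β ω : F) : Prop where
  invol : ∀ x, s (s x) = x
  comm : ∀ x, δ (s x) = s (δ x)
  map_ω : s ω = -ω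
  ω_ne : ω ≠ 0
  two_ne : (2 : F) ≠ 0
  β_ne : β ≠ 0
  s_ne_id : s ≠ RingHom.id F
  δ_ne_id : δ ≠ RingHom.id F
  δ_ne_s : δ ≠ s

variable {s δ : F →+* F} {β ω : F}

theorem twistMul_comm (x y : F) : twistMul s δ β ω x y = twistMul s δ β ω y x := by
  simp only [twistMul, map_add, map_mul]
  ring

theorem TwistData.eq_of_add_mul_eq (h : TwistData s δ β ω) {a b a' b' : F} (ha : s a = a)
    (hb : s b = b) (ha' : s a' = a') (hb' : s b' = b') (e : a + b * ω = a' + b' * ω) :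
    a = a' ∧ b = b' := by
  have e' := congrArg s e
  simp only [map_add, map_mul, ha, hb, ha', hb', h.map_ω] at e'
  have h1 : a = a' := mul_left_cancel₀ h.two_ne (by linear_combination e + e')
  refine ⟨h1, mul_right_cancel₀ h.ω_ne ?_⟩
  linear_combination e - h1

theorem TwistData.twistMul_eq_iff (h : TwistData s δ β ω) (x y x' y' : F) :
    twistMul s δ β ω x y = twistMul s δ β ω x' y' ↔
      x * s y + s x * y = x' * s y' + s x' * y' ∧
      β * (x * δ y + δ x * y) + s β * s (x * δ y + δ x * y) =
        β * (x' * δ y' + δ x' * y') + s β * s (x' * δ y' + δ x' * y') := by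
  refine ⟨fun e => h.eq_of_add_mul_eq ?_ ?_ ?_ ?_ e, fun e => by rw [twistMul, twistMul, e.1, e.2]⟩
  all_goals
    simp only [map_add, map_mul, h.invol]
    ring

/-- With `x = u * y`, vanishing of the first component gives `s u = -u`, hence `s (u + δ u) = -(u +
δ u)`. The second component then reads `(u + δ u) * (t - s t) = 0` with `t = β * (y * δ y)`, and the
two hypotheses exclude both factors. -/
theorem TwistData.isPresemifield (h : TwistData s δ β ω) [Finite F]
    (h1 : ∀ a, a + s a = 0 → a + δ a = 0 → a = 0)
    (h2 : ∀ y, y ≠ 0 → s (β * (y * δ y)) ≠ β * (y * δ y)) :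
    IsPresemifield (twistMul s δ β ω) where
  finite := inferInstance
  nontrivial := inferInstance
  mul_add a b c := by
    simp only [twistMul, map_add, map_mul]
    ring
  add_mul a b c := by
    simp only [twistMul, map_add, map_mul]
    ring
  eq_zero_or_eq_zero x y hxy := by
    by_contra! hne
    obtain ⟨hx, hy⟩ := hne
    obtain ⟨u, rfl⟩ : ∃ u, x = u * y := ⟨x / y, by field_simp⟩
    have hu : u ≠ 0 := left_ne_zero_of_mul hx
    have e0 : twistMul s δ β ω (u * y) y = twistMul s δ β ω 0 0 := by
      rw [hxy]; simp [twistMul]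
    obtain ⟨eA, eB⟩ := (h.twistMul_eq_iff _ _ _ _).1 e0
    simp only [map_add, map_mul, map_zero, mul_zero, add_zero] at eA eB
    have hsy : s y ≠ 0 := (map_ne_zero s).2 hy
    have eu : u + s u = 0 := by
      refine (mul_eq_zero.1 (?_ : (y * s y) * (u + s u) = 0)).resolve_left (mul_ne_zero hy hsy)
      linear_combination eA
    have hsδ : s (δ u) = -δ u := by
      rw [← h.comm, ← map_neg, neg_eq_of_add_eq_zero_right eu]
    have hsu : s u = -u := by linear_combination eu
    rw [hsδ, hsu] at eB
    have hv : u + δ u ≠ 0 := fun h0 => hu (h1 u eu h0)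
    refine h2 y hy (mul_left_cancel₀ hv ?_)
    simp only [map_mul]
    linear_combination -eB

/-- The sufficiency half: the map is its own adjoint for the multiplication. -/
theorem TwistData.mem_of_formula (h : TwistData s δ β ω) {m k : F} (hm : s m = m) (hm' : δ m = m)
    (hk : s β * s k = β * δ k) (x y : F) :
    twistMul s δ β ω (m * x + k * s x) y = twistMul s δ β ω x (m * y + k * s y) := by
  have hk' : β * k = s β * s (δ k) := by
    have := congrArg s hk
    simpa only [map_mul, h.invol] using this
  refine (h.twistMul_eq_iff _ _ _ _).2 ⟨?_, ?_⟩ <;>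
    simp only [map_add, map_mul, h.invol, h.comm, hm, hm']
  · ring
  · linear_combination (s x * δ y - δ x * s y) * hk' + (x * s (δ y) - s (δ x) * y) * hk

/-- The values at `1` and `ω` give `a + b = 0` and `a - b = 0`, because `s` changes the sign of `ω`.
-/
theorem TwistData.eq_zero_of_two (h : TwistData s δ β ω) (g : F →+* F) {a b : F}
    (e : ∀ y, a * g y + b * s (g y) = 0) (hg : g (s ω) = s (g ω)) : a = 0 ∧ b = 0 := by
  have e1 := e 1
  have e2 := e ω
  rw [← hg, h.map_ω, map_neg] at e2
  simp only [map_one, mul_one] at e1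
  have hgω : g ω ≠ 0 := (map_ne_zero g).2 h.ω_ne
  have e3 : a - b = 0 := mul_right_cancel₀ hgω (by linear_combination e2)
  have ha : a = 0 := mul_left_cancel₀ h.two_ne (by linear_combination e1 + e3)
  exact ⟨ha, by linear_combination e1 - ha⟩

theorem TwistData.coeff_eq_zero (h : TwistData s δ β ω) {a b c e : F}
    (H : ∀ x, a * x + b * s x + c * δ x + e * s (δ x) = 0) : a = 0 := by
  have hs : Function.Injective s := s.injective
  let v : Fin 4 → (F →* F) :=
    ![(RingHom.id F : F →* F), (s : F →* F), (δ : F →* F), (s.comp δ : F →+* F)]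
  have n01 : (RingHom.id F : F →* F) ≠ s := fun e =>
    h.s_ne_id (RingHom.ext fun x => (DFunLike.congr_fun e x).symm)
  have n02 : (RingHom.id F : F →* F) ≠ δ := fun e =>
    h.δ_ne_id (RingHom.ext fun x => (DFunLike.congr_fun e x).symm)
  have n03 : (RingHom.id F : F →* F) ≠ (s.comp δ : F →+* F) := fun e =>
    h.δ_ne_s (RingHom.ext fun x => hs (by
      rw [h.invol]; exact (DFunLike.congr_fun e x).symm))
  have n12 : (s : F →* F) ≠ δ := fun e =>
    h.δ_ne_s (RingHom.ext fun x => (DFunLike.congr_fun e x).symm)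
  have n13 : (s : F →* F) ≠ (s.comp δ : F →+* F) := fun e =>
    h.δ_ne_id (RingHom.ext fun x => hs (DFunLike.congr_fun e x).symm)
  have n23 : (δ : F →* F) ≠ (s.comp δ : F →+* F) := fun e =>
    h.s_ne_id (RingHom.ext fun x => δ.injective (by
      rw [h.comm]; exact (DFunLike.congr_fun e x).symm))
  have hv : Function.Injective v := by
    intro i j hij
    fin_cases i <;> fin_cases j <;> first | rfl | skip
    exacts [absurd hij n01, absurd hij n02, absurd hij n03, absurd hij n01.symm, absurd hij n12,
      absurd hij n13, absurd hij n02.symm, absurd hij n12.symm, absurd hij n23,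
      absurd hij n03.symm, absurd hij n13.symm, absurd hij n23.symm]
  have := Fintype.linearIndependent_iff.1 ((linearIndependent_monoidHom F F).comp v hv)
    ![a, b, c, e] (funext fun x => by simpa [Fin.sum_univ_four, v] using H x) 0
  simpa using this

/-- Adjoint pairs for the trace form `(x, y) ↦ x * s y + s x * y`. -/
theorem TwistData.exists_formula_of_adjoint (h : TwistData s δ β ω) {μ τ : F → F}
    (H : ∀ x y, μ x * s y + s (μ x) * y = x * s (τ y) + s x * τ y) :
    ∃ m k, ∀ x, μ x = m * x + k * s x := by
  have hω := h.ω_ne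
  have h2 := h.two_ne
  -- These constants come from eliminating `s (μ x)` between the instances `y = 1` and `y = ω`.
  refine ⟨(ω * s (τ 1) - s (τ ω)) / (2 * ω), (ω * τ 1 - τ ω) / (2 * ω), fun x => ?_⟩
  have e1 := H x 1
  have e2 := H x ω
  rw [h.map_ω] at e2
  simp only [map_one, mul_one] at e1
  field_simp
  linear_combination ω * e1 - e2

theorem TwistData.formula_of_mul_eq (h : TwistData s δ β ω) {μ τ : F → F}
    (H : ∀ x y, twistMul s δ β ω (μ x) y = twistMul s δ β ω x (τ y)) :
    ∃ m k, (∀ x, μ x = m * x + k * s x) ∧ s (δ m) = m ∧ s β * s k = β * δ k := by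
  have hA x y := ((h.twistMul_eq_iff _ _ _ _).1 (H x y)).1
  have hB x y := ((h.twistMul_eq_iff _ _ _ _).1 (H x y)).2
  obtain ⟨m, k, hμ⟩ := h.exists_formula_of_adjoint hA
  obtain ⟨m', k', hτ⟩ := h.exists_formula_of_adjoint (μ := τ) (τ := μ) fun x y => by
    linear_combination -hA y x
  have hid : RingHom.id F (s ω) = s (RingHom.id F ω) := rfl
  have hA1 : ∀ y, (m - s m') * s y + (s k - s k') * s (s y) = 0 := fun y => by
    have hx : ∀ x, ((m - s m') * s y + (s k - s k') * y) * x +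
        ((k - k') * s y + (s m - m') * y) * s x = 0 := fun x => by
      have := hA x y
      simp only [hμ, hτ, map_add, map_mul, h.invol] at this
      linear_combination this
    rw [h.invol]
    exact (h.eq_zero_of_two (RingHom.id F) hx hid).1
  obtain ⟨hm, hk⟩ := h.eq_zero_of_two s hA1 rfl
  have hm' : m' = s m := by rw [sub_eq_zero.1 hm, h.invol]
  have hk' : k' = k := s.injective (sub_eq_zero.1 hk).symm
  subst hm' hk'
  -- This is the coefficient of `x` in the identity for `B`; the terms `b`, `c`, `e` below are those
  -- of `s x`, `δ x` and `s (δ x)`.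
  have hB1 : ∀ y, (β * m - β * s (δ m)) * δ y + (s β * s k' - β * δ k') * s (δ y) = 0 := fun y => by
    refine h.coeff_eq_zero (b := β * k' * δ y + s β * s m * s (δ y) - s β * s (δ (τ y)))
      (c := β * δ m * y + s β * s (δ k') * s y - β * τ y)
      (e := β * δ k' * y + s β * s (δ m) * s y - s β * s (τ y)) fun x => ?_
    have := hB x y
    simp only [hμ, hτ, map_add, map_mul, h.invol, h.comm] at this ⊢
    linear_combination this
  obtain ⟨e1, e2⟩ := h.eq_zero_of_two δ hB1 (h.comm ω)
  refine ⟨m, k', hμ, ?_, sub_eq_zero.1 e2⟩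
  exact mul_left_cancel₀ h.β_ne (by linear_combination -e1)

/-- Both sides are compared at the monomial `x * y`: any expansion of `ρ` contributes nothing on the
left, and the right side contributes `s k`. -/
theorem TwistData.coeff_eq_zero_of_right (h : TwistData s δ β ω) [Finite F] {k : F}
    (ρ : AddMonoid.End F)
    (H : ∀ x y, ρ (twistMul s δ β ω x y) = twistMul s δ β ω (k * s x) y) : k = 0 := by
  classical
  have := Fintype.ofFinite F
  obtain ⟨p, hp⟩ := CharP.exists F
  have : Fact p.Prime := ⟨CharP.char_is_prime F p⟩
  let _ := ZMod.algebra F p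
  obtain ⟨r, hr⟩ := exists_eq_sum_algHom (AddMonoidHom.toZModLinearMap p (ρ : F →+ F))
  have hr' : ∀ z, ρ z = ∑ g, r g * g z := hr
  -- Each summand pairs two different automorphisms, so `coeffXY` kills it.
  have hL : (fun x y => ρ (twistMul s δ β ω x y)) = ∑ g : F →ₐ[ZMod p] F, r g •
      (homMul (g : F →+* F) ((g : F →+* F).comp s) + homMul ((g : F →+* F).comp s) (g : F →+* F) +
        (g β * g ω) • homMul (g : F →+* F) ((g : F →+* F).comp δ) +
        (g β * g ω) • homMul ((g : F →+* F).comp δ) (g : F →+* F) +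
        (g (s β) * g ω) • homMul ((g : F →+* F).comp s) ((g : F →+* F).comp (s.comp δ)) +
        (g (s β) * g ω) • homMul ((g : F →+* F).comp (s.comp δ)) ((g : F →+* F).comp s)) := by
    funext x y
    rw [hr', Finset.sum_apply, Finset.sum_apply]
    refine Finset.sum_congr rfl fun g _ => ?_
    simp only [twistMul, map_add, map_mul, Pi.smul_apply, Pi.add_apply, homMul, smul_eq_mul,
      RingHom.comp_apply, RingHom.coe_coe]
    ring
  have hR : (fun x y => twistMul s δ β ω (k * s x) y) = k • homMul s s +
      s k • homMul (RingHom.id F) (RingHom.id F) + (β * k * ω) • homMul s δ +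
      (β * δ k * ω) • homMul (s.comp δ) (RingHom.id F) +
      (s β * s k * ω) • homMul (RingHom.id F) (s.comp δ) +
      (s β * s (δ k) * ω) • homMul δ s := by
    funext x y
    simp only [twistMul, map_add, map_mul, Pi.smul_apply, Pi.add_apply, homMul, smul_eq_mul,
      RingHom.comp_apply, RingHom.id_apply, h.invol, h.comm]
    ring
  have n1 : s.comp δ ≠ RingHom.id F := fun e => h.δ_ne_s (RingHom.ext fun x => s.injective (by
    rw [h.invol]; exact DFunLike.congr_fun e x))
  have n2 : ∀ {g a b : F →+* F}, a ≠ b → g.comp a ≠ g.comp b := fun {g a b} hab e =>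
    hab (RingHom.ext fun x => g.injective (DFunLike.congr_fun e x))
  have n3 : ∀ {g a : F →+* F}, a ≠ RingHom.id F → g.comp a ≠ g := fun {g a} ha e =>
    ha (RingHom.ext fun x => g.injective (DFunLike.congr_fun e x))
  have eL := congrArg coeffXY ((funext fun x => funext fun y => (H x y).symm).trans hL)
  rw [hR] at eL
  have n4 : s.comp δ ≠ s := n3 h.δ_ne_id
  simp only [map_sum, map_add, map_smul, smul_eq_mul] at eL
  rw [coeffXY_homMul_self_eq_zero h.s_ne_id, coeffXY_homMul_id,
    coeffXY_homMul_eq_zero h.δ_ne_s.symm, coeffXY_homMul_eq_zero n1,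
    coeffXY_homMul_eq_zero n1.symm, coeffXY_homMul_eq_zero h.δ_ne_s,
    Finset.sum_eq_zero fun g _ => ?_] at eL
  · simpa using eL
  · rw [coeffXY_homMul_eq_zero (n3 h.s_ne_id), coeffXY_homMul_eq_zero (n3 h.s_ne_id).symm,
      coeffXY_homMul_eq_zero (n3 h.δ_ne_id), coeffXY_homMul_eq_zero (n3 h.δ_ne_id).symm,
      coeffXY_homMul_eq_zero (n2 n4), coeffXY_homMul_eq_zero (n2 n4.symm)]
    simp

end Twisted

/-! ### Explicit middle and right nuclei of the abstract multiplication. -/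

section Twisted

variable {F : Type*} [Field F] {s δ : F →+* F} {β ω : F}

/-- The endomorphism `x ↦ m x + k s x`. -/
def twistEnd (s : F →+* F) (m k : F) : AddMonoid.End F :=
  AddMonoidHom.mk' (fun x => m * x + k * s x) fun a b => by rw [map_add]; ring

@[simp]
theorem twistEnd_apply (m k x : F) : twistEnd s m k x = m * x + k * s x := rfl

theorem TwistData.twistEnd_injective (h : TwistData s δ β ω) {m k m' k' : F}
    (e : twistEnd s m k = twistEnd s m' k') : m = m' ∧ k = k' := by
  have := h.eq_zero_of_two (RingHom.id F) (a := m - m') (b := k - k') (fun y => by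
    have := DFunLike.congr_fun e y
    rw [twistEnd_apply, twistEnd_apply] at this
    rw [RingHom.id_apply]
    linear_combination this) rfl
  exact ⟨sub_eq_zero.1 this.1, sub_eq_zero.1 this.2⟩

theorem TwistData.mem_middleRing_iff (h : TwistData s δ β ω)
    (hP : IsPresemifield (twistMul s δ β ω)) (hfix : ∀ m, s (δ m) = m → s m = m ∧ δ m = m)
    {μ : AddMonoid.End F} :
    μ ∈ hP.middleRing ↔ ∃ m k, s (δ m) = m ∧ s β * s k = β * δ k ∧ ∀ x, μ x = m * x + k * s x := by
  rw [hP.mem_middleRing]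
  constructor
  · intro H
    choose τ hτ using H
    obtain ⟨m, k, h1, h2, h3⟩ := h.formula_of_mul_eq (μ := μ) (τ := τ) fun x y => hτ y x
    exact ⟨m, k, h2, h3, h1⟩
  · rintro ⟨m, k, hm, hk, hμ⟩ y
    refine ⟨m * y + k * s y, fun x => ?_⟩
    rw [hμ, h.mem_of_formula (hfix m hm).1 (hfix m hm).2 hk]

theorem twistMul_scalar {m : F} (hm : s m = m) (hm' : δ m = m) (x y : F) :
    twistMul s δ β ω (m * x) y = m * twistMul s δ β ω x y ∧
      twistMul s δ β ω x (m * y) = m * twistMul s δ β ω x y := by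
  constructor <;>
  · simp only [twistMul, map_add, map_mul, hm, hm']
    ring

theorem TwistData.mem_rightRing_iff (h : TwistData s δ β ω)
    (hP : IsPresemifield (twistMul s δ β ω)) (hfix : ∀ m, s (δ m) = m → s m = m ∧ δ m = m)
    {ρ : AddMonoid.End F} :
    ρ ∈ hP.rightRing ↔ ∃ m, s (δ m) = m ∧ ∀ x, ρ x = m * x := by
  have := hP.finite
  rw [hP.mem_rightRing]
  constructor
  · intro H
    choose σ hσ using H
    have hσ' x y : twistMul s δ β ω (σ x) y = ρ (twistMul s δ β ω x y) := by
      rw [twistMul_comm, ← hσ, twistMul_comm]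
    obtain ⟨m, k, h1, h2, h3⟩ := h.formula_of_mul_eq (μ := σ) (τ := σ) fun x y => by
      rw [hσ', hσ]
    obtain ⟨hs, hd⟩ := hfix m h2
    have hk : k = 0 := by
      -- Subtracting multiplication by `m` from `ρ` leaves only the part of `σ` involving `s`.
      refine h.coeff_eq_zero_of_right (ρ - twistEnd s m 0) fun x y => ?_
      have e1 := hσ' x y
      rw [h1, hP.add_mul, (twistMul_scalar hs hd x y).1] at e1
      change ρ _ - twistEnd s m 0 _ = _
      rw [← e1, twistEnd_apply]
      ring
    refine ⟨m, h2, fun z => ?_⟩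
    obtain ⟨x, rfl⟩ := hP.rmul_surjective one_ne_zero z
    rw [hP.rmul_apply, ← hσ', h1, hk, zero_mul, add_zero, (twistMul_scalar hs hd x 1).1]
  · rintro ⟨m, hm, hρ⟩ y
    obtain ⟨hs, hd⟩ := hfix m hm
    exact ⟨m * y, fun x => by rw [hρ, (twistMul_scalar hs hd x y).2]⟩

end Twisted

/-! ### Arithmetic of the Budaghyan–Helleseth parameters. -/

namespace BHConditions

variable {F : Type*} [Field F] {q l d : ℕ} {β ω : F} (h : BHConditions F q l d β ω)
include h

theorem one_lt_q : 1 < q := h.q_primePow.one_lt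

theorem finite : Finite F :=
  Nat.finite_of_card_ne_zero (by
    rw [h.card_eq]
    exact pow_ne_zero _ (by have := h.one_lt_q; omega))

theorem pow_card_sub_one {x : F} (hx : x ≠ 0) : x ^ (q ^ (2 * l) - 1) = 1 := by
  have := h.finite
  have := Fintype.ofFinite F
  rw [← h.card_eq, Nat.card_eq_fintype_card]
  exact FiniteField.pow_card_sub_one_eq_one x hx

theorem pow_card (x : F) : x ^ q ^ (2 * l) = x := by
  have := h.finite
  have := Fintype.ofFinite F
  rw [← h.card_eq, Nat.card_eq_fintype_card]
  exact FiniteField.pow_card x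

theorem exists_powHom (i : ℕ) : ∃ φ : F →+* F, ∀ x, φ x = x ^ q ^ i := by
  have := h.finite
  have := Fintype.ofFinite F
  obtain ⟨p, e, hp, -, he⟩ := h.q_primePow
  have : Fact p.Prime := ⟨hp.nat_prime⟩
  have : CharP F p := charP_of_card_eq_prime_pow (f := e * (2 * l)) (by
    rw [← Nat.card_eq_fintype_card, h.card_eq, ← he, ← pow_mul])
  exact ⟨iterateFrobenius F p (e * i), fun x => by rw [iterateFrobenius_def, ← he, pow_mul]⟩

theorem two_ne_zero : (2 : F) ≠ 0 := fun h2 => by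
  have := h.finite
  have := Fintype.ofFinite F
  have hc := FiniteField.cast_card_eq_zero F
  rw [← Nat.card_eq_fintype_card, h.card_eq] at hc
  obtain ⟨k, hk⟩ := h.q_odd.pow (n := 2 * l)
  rw [hk] at hc
  push_cast at hc
  rw [h2, zero_mul, zero_add] at hc
  exact one_ne_zero hc

theorem ω_ne_zero : ω ≠ 0 := by
  rintro rfl
  have := h.one_lt_q
  exact h.ω_notMem (zero_pow (pow_ne_zero _ (by omega)))

/-- If `l + d` were even, coprimality would make both odd. A power of `ω` whose `q`-th power is its
negative would then be negated by both `q ^ l` and `q ^ d`, which `not_exists` forbids. -/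
theorem odd_add : Odd (l + d) := by
  by_contra hodd
  have hq := h.one_lt_q
  have hl : Odd l := by
    by_contra hl
    have h1 : 2 ∣ l := even_iff_two_dvd.1 (Nat.not_odd_iff_even.1 hl)
    have h2 : 2 ∣ l + d := even_iff_two_dvd.1 (Nat.not_odd_iff_even.1 hodd)
    have h3 : 2 ∣ d := (Nat.dvd_add_right h1).1 h2
    have := Nat.dvd_gcd h1 h3
    rw [h.coprime] at this
    omega
  have hd : Odd d := by
    by_contra hd
    exact hodd (hl.add_even (Nat.not_odd_iff_even.1 hd))
  have hω : ω ^ (q ^ l - 1) = -1 := by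
    refine mul_right_cancel₀ h.ω_ne_zero ?_
    rw [pow_sub_one_mul (pow_ne_zero _ (by omega)), h.ω_conj, neg_one_mul]
  -- Here `j = (q ^ l - 1) / (q - 1)`, so that `(ω ^ j) ^ (q - 1) = -1`.
  obtain ⟨j, hj⟩ := Nat.sub_one_dvd_pow_sub_one q l
  have ha : (ω ^ j) ^ q = -ω ^ j := by
    rw [← pow_sub_one_mul (by omega : q ≠ 0), ← pow_mul, mul_comm j, ← hj, hω, neg_one_mul]
  have hn : ∀ n, (ω ^ j) ^ q ^ n = (-1) ^ n * ω ^ j := fun n => by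
    induction n with
    | zero => simp
    | succ n ih =>
      rw [pow_succ q, pow_mul, ih, mul_pow, ha, ← pow_mul, mul_comm n, pow_mul, h.q_odd.neg_one_pow]
      ring
  refine h.not_exists ⟨ω ^ j, pow_ne_zero _ h.ω_ne_zero, ?_, ?_⟩
  · rw [hn, hl.neg_one_pow]; ring
  · rw [hn, hd.neg_one_pow]; ring

theorem gcd_add : (l + d).gcd (2 * l) = 1 := by
  have h1 : Nat.Coprime (l + d) l := by
    rw [Nat.coprime_self_add_left]
    exact Nat.Coprime.symm h.coprime
  exact Nat.Coprime.mul_right (Nat.coprime_two_right.2 h.odd_add) h1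

/-- Under `x ↦ x ^ q` every point has period `2 * l`; if `l + d` is also a period, so is their gcd,
which is `1`. -/
theorem pow_eq_self_iff (a : F) : a ^ q ^ (l + d) = a ↔ a ^ q = a := by
  have key : ∀ n, Function.IsPeriodicPt (fun x : F => x ^ q) n a ↔ a ^ q ^ n = a := fun n => by
    rw [Function.IsPeriodicPt, Function.IsFixedPt, pow_iterate]
  constructor
  · intro ha
    have := ((key _).2 ha).gcd ((key _).2 (h.pow_card a))
    rwa [h.gcd_add, key, pow_one] at this
  · intro ha
    exact (key _).1 (((key 1).2 (by rwa [pow_one])).trans_dvd (one_dvd _))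

omit h in
theorem pow_pow_eq_self {a : F} (ha : a ^ q = a) (n : ℕ) : a ^ q ^ n = a := by
  induction n with
  | zero => simp
  | succ n ih => rw [pow_succ, pow_mul, ih, ha]

theorem exists_pow_ne (hd : 0 < d) : ∃ x : F, x ^ q ^ d ≠ x := by
  by_contra! H
  have := h.finite
  have := Fintype.ofFinite F
  have hq := h.one_lt_q
  have h1 : Fintype.card F - 1 ∣ q ^ d - 1 := (FiniteField.forall_pow_eq_one_iff F _).1 fun x =>
    Units.ext <| mul_right_cancel₀ x.ne_zero <| by
      rw [Units.val_pow_eq_pow_val, pow_sub_one_mul (pow_ne_zero _ (by omega)), H, Units.val_one,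
        one_mul]
  rw [← Nat.card_eq_fintype_card, h.card_eq] at h1
  have h2 := Nat.one_lt_pow hd.ne' hq
  have h3 := Nat.pow_lt_pow_right hq h.d_lt
  have := Nat.le_of_dvd (by omega) h1
  omega

theorem exists_twistData : ∃ s δ : F →+* F, (∀ x, s x = x ^ q ^ l) ∧ (∀ x, δ x = x ^ q ^ d) ∧
    TwistData s δ β ω ∧ bhMul q l d β ω = twistMul s δ β ω := by
  obtain ⟨s, hs⟩ := h.exists_powHom l
  obtain ⟨δ, hδ⟩ := h.exists_powHom d
  have invol : ∀ x, s (s x) = x := fun x => by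
    rw [hs, hs, ← pow_mul, ← pow_add, ← two_mul, h.pow_card]
  refine ⟨s, δ, hs, hδ, ⟨invol, fun x => ?_, by rw [hs, h.ω_conj], h.ω_ne_zero, h.two_ne_zero,
    h.β_ne_zero, fun e => ?_, fun e => ?_, fun e => ?_⟩, ?_⟩
  · rw [hs, hδ, hs, hδ, ← pow_mul, ← pow_mul, mul_comm]
  · exact h.ω_notMem (by rw [← hs, e, RingHom.id_apply])
  · obtain ⟨x, hx⟩ := h.exists_pow_ne h.d_pos
    exact hx (by rw [← hδ, e, RingHom.id_apply])
  -- If `δ = s`, then `s ∘ δ` is the identity, which would put `ω` in `𝔽_q`.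
  · have hx : ω ^ q ^ (l + d) = ω := by
      rw [pow_add, pow_mul, ← hs, ← hδ, e, invol]
    exact h.ω_notMem (pow_pow_eq_self ((h.pow_eq_self_iff ω).1 hx) l)
  · funext x y
    simp only [bhMul, twistMul, hs, hδ]

/-- Write `g` for the gcd and `q ^ l + 1 = g * A`. The exponent in `β_pow_ne_one` is `A * (q ^ l -
1)`. It kills `y ^ (q ^ d + 1)`, since `g` divides `q ^ d + 1`, and it would kill an element fixed
by `s`; hence it would kill `β`. -/
theorem pow_norm_ne {y : F} (hy : y ≠ 0) :
    (β * (y * y ^ q ^ d)) ^ q ^ l ≠ β * (y * y ^ q ^ d) := fun H => by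
  have hq := h.one_lt_q
  refine h.β_pow_ne_one ?_
  rw [← pow_succ'] at H
  set t := β * y ^ (q ^ d + 1) with ht
  have ht0 : t ≠ 0 := mul_ne_zero h.β_ne_zero (pow_ne_zero _ hy)
  have ht1 : t ^ (q ^ l - 1) = 1 := by
    refine mul_right_cancel₀ ht0 ?_
    rw [pow_sub_one_mul (pow_ne_zero _ (by omega)), H, one_mul]
  obtain ⟨A, hA⟩ := Nat.gcd_dvd_left (q ^ l + 1) (q ^ d + 1)
  obtain ⟨B, hB⟩ := Nat.gcd_dvd_right (q ^ l + 1) (q ^ d + 1)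
  set g := Nat.gcd (q ^ l + 1) (q ^ d + 1)
  have hg : 0 < g := Nat.gcd_pos_of_pos_left _ (Nat.succ_pos _)
  have hQ : q ^ (2 * l) - 1 = g * (A * (q ^ l - 1)) := by
    rw [← mul_assoc, ← hA, mul_comm 2, pow_mul]
    exact Nat.sq_sub_sq (q ^ l) 1
  rw [hQ, Nat.mul_div_cancel_left _ hg]
  have e1 : (y ^ (q ^ d + 1)) ^ (A * (q ^ l - 1)) = 1 := by
    rw [hB, ← pow_mul, show g * B * (A * (q ^ l - 1)) = g * (A * (q ^ l - 1)) * B by ring, ← hQ,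
      pow_mul, h.pow_card_sub_one hy, one_pow]
  have e2 : t ^ (A * (q ^ l - 1)) = 1 := by rw [mul_comm, pow_mul, ht1, one_pow]
  rwa [ht, mul_pow, e1, mul_one] at e2

theorem isPresemifield : IsPresemifield (bhMul q l d β ω) := by
  have := h.finite
  obtain ⟨s, δ, hs, hδ, hT, hb⟩ := h.exists_twistData
  rw [hb]
  refine hT.isPresemifield (fun a h1 h2 => ?_) fun y hy => ?_
  · by_contra ha
    exact h.not_exists ⟨a, ha, by rwa [← hs], by rwa [← hδ]⟩
  · rw [hs, hδ]
    exact h.pow_norm_ne hy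

theorem card_fixed : Nat.card {a : F // a ^ q = a} = q := by
  have := h.finite
  have hq := h.one_lt_q
  have hker : Nat.card (powMonoidHom (q - 1) : Fˣ →* Fˣ).ker = q - 1 := by
    rw [IsCyclic.card_powMonoidHom_ker, Nat.card_units, h.card_eq]
    exact Nat.gcd_eq_right (Nat.sub_one_dvd_pow_sub_one q _)
  have hset : {a : F | a ^ q = a} =
      insert 0 ((fun u : Fˣ => (u : F)) '' (powMonoidHom (q - 1) : Fˣ →* Fˣ).ker) := by
    ext a
    simp only [Set.mem_ofPred_eq, Set.mem_insert_iff, Set.mem_image, SetLike.mem_coe,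
      MonoidHom.mem_ker, powMonoidHom_apply]
    constructor
    · intro ha
      refine or_iff_not_imp_left.2 fun h0 => ⟨Units.mk0 a h0, Units.ext ?_, rfl⟩
      refine mul_right_cancel₀ h0 ?_
      rw [Units.val_pow_eq_pow_val, Units.val_mk0, pow_sub_one_mul (by omega), ha, Units.val_one,
        one_mul]
    · rintro (rfl | ⟨u, hu, rfl⟩)
      · exact zero_pow (by omega)
      · rw [← pow_sub_one_mul (by omega : q ≠ 0), ← Units.val_pow_eq_pow_val, hu, Units.val_one,
          one_mul]
  have : {a : F | a ^ q = a}.ncard = q := by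
    rw [hset, Set.ncard_insert_of_notMem (by simp) (Set.toFinite _),
      Set.ncard_image_of_injective _ Units.val_injective, ← Nat.card_coe_set_eq]
    have : Nat.card ((powMonoidHom (q - 1) : Fˣ →* Fˣ).ker : Set Fˣ) = q - 1 := hker
    omega
  rwa [← Nat.card_coe_set_eq] at this

/-- The right side is `c ^ (q - 1)` for a power `c` of `β⁻¹`. Since `q - 1` is the gcd of `q ^ (l +
d) - 1` and the group order, a Bézout coefficient gives the root as a power of `c`. -/
theorem exists_root : ∃ ξ : F, ξ ^ (q ^ (l + d) - 1) = β / β ^ q ^ l := by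
  have hq := h.one_lt_q
  obtain ⟨j, hj⟩ := Nat.sub_one_dvd_pow_sub_one q l
  set c := β⁻¹ ^ j with hc
  have hc0 : c ≠ 0 := pow_ne_zero _ (inv_ne_zero h.β_ne_zero)
  have hcq : c ^ (q - 1) = β / β ^ q ^ l := by
    rw [hc, ← pow_mul, mul_comm, ← hj, inv_pow, eq_div_iff (pow_ne_zero _ h.β_ne_zero),
      ← pow_sub_one_mul (pow_ne_zero l (by omega : q ≠ 0)) β, ← mul_assoc,
      inv_mul_cancel₀ (pow_ne_zero _ h.β_ne_zero), one_mul]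
  have hgcd : Nat.gcd (q ^ (l + d) - 1) (q ^ (2 * l) - 1) = q - 1 := by
    rw [Nat.pow_sub_one_gcd_pow_sub_one, h.gcd_add, pow_one]
  have hbez := Nat.gcd_eq_gcd_ab (q ^ (l + d) - 1) (q ^ (2 * l) - 1)
  rw [hgcd] at hbez
  refine ⟨c ^ Nat.gcdA (q ^ (l + d) - 1) (q ^ (2 * l) - 1), ?_⟩
  rw [← hcq, ← zpow_natCast c, hbez, zpow_add₀ hc0, zpow_mul c ((q ^ (2 * l) - 1 : ℕ) : ℤ),
    zpow_natCast c (q ^ (2 * l) - 1), h.pow_card_sub_one hc0, one_zpow, mul_one, ← zpow_natCast,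
    ← zpow_mul, mul_comm]

theorem root_ne_zero {ξ : F} (hξ : ξ ^ (q ^ (l + d) - 1) = β / β ^ q ^ l) : ξ ≠ 0 := by
  rintro rfl
  have h2 : 1 < q ^ (l + d) := Nat.one_lt_pow (by have := h.d_pos; omega) h.one_lt_q
  rw [zero_pow (by omega)] at hξ
  exact div_ne_zero h.β_ne_zero (pow_ne_zero _ h.β_ne_zero) hξ.symm

theorem coeff_iff {s δ : F →+* F} (hs : ∀ x, s x = x ^ q ^ l) (hδ : ∀ x, δ x = x ^ q ^ d)
    (hT : TwistData s δ β ω) {ξ : F} (hξ : ξ ^ (q ^ (l + d) - 1) = β / β ^ q ^ l) (k : F) :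
    s β * s k = β * δ k ↔ ∃ b, b ^ q = b ∧ k = b * ξ := by
  have hq := h.one_lt_q
  have hβ : β ^ q ^ l ≠ 0 := pow_ne_zero _ h.β_ne_zero
  have hξ0 := h.root_ne_zero hξ
  have hξ' : ξ ^ q ^ (l + d) = β / β ^ q ^ l * ξ := by
    rw [← hξ, pow_sub_one_mul (pow_ne_zero _ (by omega))]
  -- Applying `s` turns the condition into an equation for the power `q ^ (l + d)` alone; the
  -- quotient of a solution by `ξ` is then fixed by that power.
  have h1 : s β * s k = β * δ k ↔ k ^ q ^ (l + d) = β / β ^ q ^ l * k := by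
    rw [← s.injective.eq_iff, map_mul, map_mul, hT.invol, hT.invol, ← hT.comm, hs β, hs k,
      hδ, ← pow_mul, ← pow_add, div_mul_eq_mul_div, eq_div_iff hβ, mul_comm (k ^ _), eq_comm]
  rw [h1]
  constructor
  · intro hk
    refine ⟨k / ξ, (h.pow_eq_self_iff _).1 ?_, (div_mul_cancel₀ k hξ0).symm⟩
    rw [div_pow, hk, hξ', mul_div_mul_left _ _ (div_ne_zero h.β_ne_zero hβ)]
  · rintro ⟨b, hb, rfl⟩
    rw [mul_pow, (h.pow_eq_self_iff b).2 hb, hξ']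
    ring

theorem fixed_iff {s δ : F →+* F} (hs : ∀ x, s x = x ^ q ^ l) (hδ : ∀ x, δ x = x ^ q ^ d) (m : F) :
    s (δ m) = m ↔ m ^ q = m := by
  rw [hs, hδ, ← pow_mul, ← pow_add, add_comm d, h.pow_eq_self_iff]

theorem mem_middleRing_iff {ξ : F} (hξ : ξ ^ (q ^ (l + d) - 1) = β / β ^ q ^ l)
    {μ : AddMonoid.End F} : μ ∈ h.isPresemifield.middleRing ↔
      ∃ a b : F, a ^ q = a ∧ b ^ q = b ∧ ∀ x, μ x = a * x + b * ξ * x ^ q ^ l := by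
  obtain ⟨s, δ, hs, hδ, hT, hb⟩ := h.exists_twistData
  generalize h.isPresemifield = hP
  revert hP
  rw [hb]
  intro hP
  rw [hT.mem_middleRing_iff hP fun m hm => by
    have := (h.fixed_iff hs hδ m).1 hm
    rw [hs, hδ, pow_pow_eq_self this, pow_pow_eq_self this]; exact ⟨rfl, rfl⟩]
  simp only [h.fixed_iff hs hδ, h.coeff_iff hs hδ hT hξ, ← hs]
  constructor
  · rintro ⟨m, _, hm, ⟨b, hb, rfl⟩, H⟩
    exact ⟨m, b, hm, hb, H⟩
  · rintro ⟨m, b, hm, hb, H⟩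
    exact ⟨m, _, hm, ⟨b, hb, rfl⟩, H⟩

theorem mem_rightRing_iff {ρ : AddMonoid.End F} :
    ρ ∈ h.isPresemifield.rightRing ↔ ∃ a : F, a ^ q = a ∧ ∀ x, ρ x = a * x := by
  obtain ⟨s, δ, hs, hδ, hT, hb⟩ := h.exists_twistData
  generalize h.isPresemifield = hP
  revert hP
  rw [hb]
  intro hP
  rw [hT.mem_rightRing_iff hP fun m hm => by
    have := (h.fixed_iff hs hδ m).1 hm
    rw [hs, hδ, pow_pow_eq_self this, pow_pow_eq_self this]; exact ⟨rfl, rfl⟩]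
  simp only [h.fixed_iff hs hδ]

theorem bhMul_scalar {a : F} (ha : a ^ q = a) (x y : F) :
    bhMul q l d β ω (a * x) y = a * bhMul q l d β ω x y ∧
      bhMul q l d β ω x (a * y) = a * bhMul q l d β ω x y := by
  obtain ⟨s, δ, hs, hδ, -, hb⟩ := h.exists_twistData
  rw [hb]
  exact twistMul_scalar (by rw [hs, pow_pow_eq_self ha]) (by rw [hδ, pow_pow_eq_self ha]) x y

theorem dual_bhMul : dual (bhMul q l d β ω) = bhMul q l d β ω := by
  obtain ⟨s, δ, -, -, -, hb⟩ := h.exists_twistData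
  rw [hb]
  exact funext fun x => funext fun y => twistMul_comm y x

theorem card_middleRing : Nat.card h.isPresemifield.middleRing = q ^ 2 := by
  obtain ⟨ξ, hξ⟩ := h.exists_root
  obtain ⟨s, δ, hs, hδ, hT, -⟩ := h.exists_twistData
  have hξ0 := h.root_ne_zero hξ
  let f : {a : F // a ^ q = a} × {a : F // a ^ q = a} → h.isPresemifield.middleRing := fun p =>
    ⟨twistEnd s p.1 (p.2 * ξ), (h.mem_middleRing_iff hξ).2
      ⟨p.1, p.2, p.1.2, p.2.2, fun x => by rw [twistEnd_apply, hs]⟩⟩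
  have hf : Function.Bijective f := by
    refine ⟨fun p p' e => ?_, fun ⟨μ, hμ⟩ => ?_⟩
    · obtain ⟨e1, e2⟩ := hT.twistEnd_injective (congrArg Subtype.val e)
      exact Prod.ext (Subtype.ext e1) (Subtype.ext (mul_right_cancel₀ hξ0 e2))
    · obtain ⟨a, b, ha, hb, H⟩ := (h.mem_middleRing_iff hξ).1 hμ
      refine ⟨(⟨a, ha⟩, ⟨b, hb⟩), Subtype.ext (DFunLike.ext _ _ fun x => ?_)⟩
      rw [H, ← hs]
      rfl
  rw [← Nat.card_congr (Equiv.ofBijective f hf), Nat.card_prod, h.card_fixed, sq]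

theorem card_rightRing : Nat.card h.isPresemifield.rightRing = q := by
  let f : {a : F // a ^ q = a} → h.isPresemifield.rightRing := fun a =>
    ⟨AddMonoidHom.mulLeft a.1, h.mem_rightRing_iff.2 ⟨a, a.2, fun _ => rfl⟩⟩
  have hf : Function.Bijective f := by
    refine ⟨fun a b e => Subtype.ext ?_, fun ⟨ρ, hρ⟩ => ?_⟩
    · have : a.1 * 1 = b.1 * 1 := DFunLike.congr_fun (congrArg Subtype.val e) 1
      simpa using this
    · obtain ⟨a, ha, H⟩ := h.mem_rightRing_iff.1 hρ
      exact ⟨⟨a, ha⟩, Subtype.ext (DFunLike.ext _ _ fun x => (H x).symm)⟩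
  rw [← Nat.card_congr (Equiv.ofBijective f hf), h.card_fixed]

theorem isCenterOf (w : (AddMonoid.End F)ˣ)
    (hw : (w : AddMonoid.End F) ∈ spreadSet (bhMul q l d β ω)) :
    IsCenterOf (bhMul q l d β ω) w h.isPresemifield.rightRing := by
  refine ⟨_, h.isPresemifield.isRightNucleusOf_rightRing,
    ⟨h.isPresemifield.isField_rightRing, le_rfl, fun ρ hρ φ hφ => ?_⟩, fun M hM => hM.2.1⟩
  obtain ⟨a, ha, H⟩ := h.mem_rightRing_iff.1 hρ
  have comm : ∀ ψ ∈ spreadSet (bhMul q l d β ω), ρ * ψ = ψ * ρ := by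
    rintro ψ ⟨y, hy⟩
    refine DFunLike.ext _ _ fun x => ?_
    change ρ (ψ x) = ψ (ρ x)
    rw [H, H, hy, hy, (h.bhMul_scalar ha x y).1]
  rw [mul_assoc, comm _ hw, ← mul_assoc (↑w⁻¹ : AddMonoid.End F), Units.inv_mul, one_mul,
    comm _ hφ]

end BHConditions

end PreSF

/-! ### Assembly, with transfer to isotopic semifields. -/

open PreSF
theorem mainTheorem1 {F : Type u} [Field F] (q l d : ℕ) (β ω : F)
    (hl : 1 < l) (hBH : BHConditions F q l d β ω) :
    -- the multiplication is that of a presemifield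
    IsPresemifield (bhMul q l d β ω) ∧
    -- orders of the nuclei and the center of every isotopic semifield
    (∀ (S : Type v) [AddCommGroup S] (mul : S → S → S), IsSemifield mul →
      Isotopic (bhMul q l d β ω) mul →
        (middleNucleus mul).ncard = q ^ 2 ∧ (rightNucleus mul).ncard = q ∧
        (leftNucleus mul).ncard = q ∧ (center mul).ncard = q) ∧
    -- the nuclei and the center of the presemifield, as fields of endomorphisms
    (∃ N : Subring (AddMonoid.End F), IsMiddleNucleusOf (bhMul q l d β ω) N ∧
      Nat.card N = q ^ 2 ∧
      (∃ ξ : F, ξ ^ (q ^ (l + d) - 1) = β / β ^ q ^ l) ∧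
      (∀ ξ : F, ξ ^ (q ^ (l + d) - 1) = β / β ^ q ^ l →
        ∀ ψ : AddMonoid.End F, ψ ∈ N ↔
          ∃ a b : F, a ^ q = a ∧ b ^ q = b ∧ ∀ x, ψ x = a * x + b * ξ * x ^ q ^ l)) ∧
    (∃ N : Subring (AddMonoid.End F), IsRightNucleusOf (bhMul q l d β ω) N ∧ Nat.card N = q) ∧
    (∃ N : Subring (AddMonoid.End F), IsLeftNucleusOf (bhMul q l d β ω) N ∧ Nat.card N = q) ∧
    (∀ w : (AddMonoid.End F)ˣ, (w : AddMonoid.End F) ∈ spreadSet (bhMul q l d β ω) →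
      ∃ K : Subring (AddMonoid.End F), IsCenterOf (bhMul q l d β ω) w K ∧ Nat.card K = q) := by
  have hP := hBH.isPresemifield
  have hR := hP.isRightNucleusOf_rightRing
  refine ⟨hP, fun S _ mul hS hI => ?_,
    ⟨_, hP.isMiddleNucleusOf_middleRing, hBH.card_middleRing, hBH.exists_root,
      fun ξ hξ ψ => hBH.mem_middleRing_iff hξ⟩,
    ⟨_, hR, hBH.card_rightRing⟩,
    ⟨hP.rightRing, by rwa [IsLeftNucleusOf, hBH.dual_bhMul], hBH.card_rightRing⟩,
    fun w hw => ⟨_, hBH.isCenterOf w hw, hBH.card_rightRing⟩⟩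
  have hr : (rightNucleus mul).ncard = q := by
    rw [hS.ncard_rightNucleus, hI.card_rightRing hP, hBH.card_rightRing]
  refine ⟨?_, hr, ?_, ?_⟩
  · rw [hS.ncard_middleNucleus, hI.card_middleRing hP, hBH.card_middleRing]
  · have hI' := hI.dual
    rw [hBH.dual_bhMul] at hI'
    rw [← rightNucleus_dual, hS.dual.ncard_rightNucleus, hI'.card_rightRing hP, hBH.card_rightRing]
  · rw [hI.center_eq hP hS fun ρ hρ x y => ?_, hr]
    obtain ⟨a, ha, H⟩ := hBH.mem_rightRing_iff.1 hρ
    rw [H, H, H]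
    exact hBH.bhMul_scalar ha x y
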